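/- Let $G$ be a group and $p$ a prime. The $p$-local commensurability graph $\Gamma_p(G)$ is the graph whose vertices are the finite-index subgroups of $G$, with two distinct vertices $A, B$ adjacent if and only if $[A : A\cap B]\,[B : A\cap B]$ is a power of $p$. The group $G$ is called large if it contains a finite-index subgroup that admits a surjective homomorphism onto a non-cyclic free group. If $G$ is a large group and $p$ is a prime, then there exists a connected component of $\Gamma_p(G)$ that contains no normal subgroup of $G$ as a vertex. -/

import Mathlib

/-- A group is large if it contains a finite-index subgroup that admits a surjective homomorphism
onto a non-cyclic free group. (Such a free group is a quotient of a subgroup of `G`, so a basis of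
it can always be taken in the universe of `G`.) -/
def IsLargeGroup.{u} (G : Type u) [Group G] : Prop :=
  ∃ H : Subgroup G, H.FiniteIndex ∧ ∃ (ι : Type u) (f : H →* FreeGroup ι),
    ¬ IsCyclic (FreeGroup ι) ∧ Function.Surjective f

/-- The `p`-local commensurability graph of `G`: its vertices are the finite-index subgroups of
`G`, and distinct `A`, `B` are adjacent iff `[A : A ∩ B] [B : A ∩ B]` is a power of `p`.
(`K.relIndex H` is the index of `K ∩ H` in `H`.) -/
def pLocalCommensurabilityGraph (p : ℕ) (G : Type*) [Group G] :
    SimpleGraph {A : Subgroup G // A.FiniteIndex} where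
  Adj A B := A ≠ B ∧
    ∃ n : ℕ, (A.1 ⊓ B.1).relIndex A.1 * (A.1 ⊓ B.1).relIndex B.1 = p ^ n
  symm := ⟨fun A B h => ⟨h.1.symm, by
    obtain ⟨n, hn⟩ := h.2
    exact ⟨n, by rw [inf_comm, mul_comm]; exact hn⟩⟩⟩
  loopless := ⟨fun _ h => h.1 rfl⟩

/-! For `M` normal of finite index, the prime-to-`p` part of `[A : A ∩ M]` is constant on
components. Take `M` to be the core of the kernel of a map from `H` onto `S_q`, `q` a large prime,
and start from some `A` with `[A : M] = q`. For a normal `N` in its component, `q` divides `[N : N ∩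
M]`, which forces `N ∩ H` to have nontrivial, hence normal, image in `S_q`. That image contains
`A_q`, so 2 and 3 both divide `[N : N ∩ M]`; the invariant then makes both equal to `p`. -/

/-- If `C ≤ A` has `p`-power index in `A`, the indices of a normal subgroup `M` relative to `A` and
to `C` differ by a power of `p`. -/
theorem Subgroup.relIndex_eq_pow_mul_of_relIndex_eq_pow {G : Type*} [Group G] {M A C : Subgroup G}
    [M.Normal] [M.FiniteIndex] (hCA : C ≤ A) {p n : ℕ} (hp : p.Prime) (h : C.relIndex A ∣ p ^ n) :
    ∃ a, M.relIndex A = p ^ a * M.relIndex C := by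
  have hdvd : M.relIndex C ∣ M.relIndex A := by
    rw [← Subgroup.relIndex_subgroupOf hCA]
    exact Subgroup.relIndex_dvd_index_of_normal _ _
  obtain ⟨k, hk⟩ := hdvd
  -- Compute `[A : M ∩ C]` through `M ∩ A` and through `C`: the ratio `k` divides `[A : C]`.
  have h1 := Subgroup.relIndex_inf_mul_relIndex C M A
  have h2 := Subgroup.relIndex_inf_mul_relIndex M C A
  have hC : M.relIndex C ≠ 0 := Subgroup.FiniteIndex.index_ne_zero
  rw [inf_comm C M, ← h2, inf_eq_left.2 hCA, hk] at h1
  have h3 : C.relIndex (M ⊓ A) * k = C.relIndex A :=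
    Nat.eq_of_mul_eq_mul_left (Nat.pos_of_ne_zero hC) (by rw [← h1]; ring)
  obtain ⟨a, -, ha⟩ := (Nat.dvd_prime_pow hp).1 ((Dvd.intro_left _ h3).trans h)
  exact ⟨a, by rw [hk, ha, mul_comm]⟩

/-- Along a component of the `p`-local commensurability graph, the index of a fixed normal subgroup
relative to the vertices changes only by powers of `p`. -/
theorem pLocalCommensurabilityGraph.pow_mul_relIndex_eq_of_reachable {G : Type*} [Group G] {p : ℕ}
    (hp : p.Prime) (M : Subgroup G) [M.Normal] [M.FiniteIndex]
    {A B : {A : Subgroup G // A.FiniteIndex}}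
    (h : (pLocalCommensurabilityGraph p G).Reachable A B) :
    ∃ a b, p ^ a * M.relIndex A.1 = p ^ b * M.relIndex B.1 := by
  obtain ⟨w⟩ := h
  induction w with
  | nil => exact ⟨0, 0, rfl⟩
  | cons hadj _ ih =>
    obtain ⟨a, b, hab⟩ := ih
    obtain ⟨-, n, hn⟩ := hadj
    obtain ⟨c, hc⟩ := Subgroup.relIndex_eq_pow_mul_of_relIndex_eq_pow (M := M)
      inf_le_left hp (Dvd.intro _ hn)
    obtain ⟨d, hd⟩ := Subgroup.relIndex_eq_pow_mul_of_relIndex_eq_pow (M := M)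
      inf_le_right hp (Dvd.intro_left _ hn)
    refine ⟨a + d, b + c, ?_⟩
    rw [pow_add, pow_add, mul_right_comm (p ^ b), ← hab, hc, hd]
    ring

/-- A free group that is not cyclic surjects onto the symmetric group on a prime number of
letters. -/
theorem FreeGroup.exists_surjective_perm {ι : Type*} (h : ¬ IsCyclic (FreeGroup ι)) {q : ℕ}
    (hq : q.Prime) : ∃ f : FreeGroup ι →* Equiv.Perm (Fin q), Function.Surjective f := by
  classical
  have : Nontrivial ι := by
    by_contra hι
    rw [not_nontrivial_iff_subsingleton] at hι
    rcases isEmpty_or_nonempty ι with hE | ⟨⟨i⟩⟩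
    · exact h inferInstance
    · have := uniqueOfSubsingleton i
      exact h inferInstance
  obtain ⟨i, j, hij⟩ := exists_pair_ne ι
  let x : Fin q := ⟨0, hq.pos⟩
  let y : Fin q := ⟨1, hq.one_lt⟩
  -- For prime `q`, a `q`-cycle and any transposition generate `S_q`.
  let g : ι → Equiv.Perm (Fin q) := fun k => if k = i then finRotate q else Equiv.swap x y
  refine ⟨FreeGroup.lift g, ?_⟩
  rw [← MonoidHom.range_eq_top, eq_top_iff,
    ← Equiv.Perm.closure_prime_cycle_swap (σ := finRotate q) (τ := Equiv.swap x y)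
      (by simpa using hq) (isCycle_finRotate_of_le hq.two_le) (support_finRotate_of_le hq.two_le)
      ⟨x, y, by simp [x, y], rfl⟩, Subgroup.closure_le]
  rintro _ (rfl | rfl)
  · exact ⟨FreeGroup.of i, by simp [g]⟩
  · exact ⟨FreeGroup.of j, by simp [g, hij.symm]⟩

/-- The order of a nontrivial normal subgroup of the symmetric group on `q ≥ 5` letters is divisible
by `12`. -/
theorem Equiv.Perm.twelve_dvd_card_of_normal {q : ℕ} (hq : 5 ≤ q)
    {N : Subgroup (Equiv.Perm (Fin q))} [N.Normal] (hN : N ≠ ⊥) : 12 ∣ Nat.card N := by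
  have hle : alternatingGroup (Fin q) ≤ N :=
    Equiv.Perm.alternatingGroup_le_of_normal (by simpa using hq)
      ((Subgroup.nontrivial_iff_ne_bot _).2 hN)
  have : Nontrivial (Fin q) := Fin.nontrivial_iff_two_le.2 (by omega)
  refine Dvd.dvd.trans ?_ (Subgroup.card_dvd_of_le hle)
  have h := two_mul_nat_card_alternatingGroup (α := Fin q)
  rw [Nat.card_perm, Nat.card_fin] at h
  have h4 : Nat.factorial 4 ∣ Nat.factorial q := Nat.factorial_dvd_factorial (by omega)
  rw [← h, show Nat.factorial 4 = 2 * 12 from rfl] at h4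
  exact Nat.dvd_of_mul_dvd_mul_left two_pos h4

/-- A normal subgroup `M` of finite index whose index is divisible by a prime `q` has index `q` in
some finite-index subgroup. -/
theorem Subgroup.exists_relIndex_eq_prime {G : Type*} [Group G] (M : Subgroup G) [M.Normal]
    [M.FiniteIndex] {q : ℕ} (hq : q.Prime) (h : q ∣ M.index) :
    ∃ A : Subgroup G, A.FiniteIndex ∧ M.relIndex A = q := by
  have := Fact.mk hq
  -- Cauchy's theorem in `G ⧸ M`; the subgroup sought is the preimage of `⟨x⟩`.
  obtain ⟨x, hx⟩ := exists_prime_orderOf_dvd_card' (G := G ⧸ M) q h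
  have hle : M ≤ (Subgroup.zpowers x).comap (QuotientGroup.mk' M) := by
    conv_lhs => rw [← QuotientGroup.ker_mk' M]
    exact MonoidHom.ker_le_comap _ _
  refine ⟨_, Subgroup.finiteIndex_of_le hle, ?_⟩
  have hker := Subgroup.relIndex_ker ((Subgroup.zpowers x).comap (QuotientGroup.mk' M))
    (QuotientGroup.mk' M)
  rw [QuotientGroup.ker_mk'] at hker
  rw [hker, Subgroup.map_comap_eq_self_of_surjective
    (QuotientGroup.mk'_surjective M), Nat.card_zpowers, hx]

/-- Let `H` map onto the symmetric group on `q ≥ 5` letters, where `q` exceeds the index of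
the core of `H`, and let `M` be the core in `G` of the kernel. Then any normal subgroup `N` of `G`
for which `q` divides `[N : N ∩ M]` satisfies `12 ∣ [N : N ∩ M]`. -/
theorem Subgroup.twelve_dvd_relIndex_normalCore {G : Type*} [Group G] {H : Subgroup G}
    [H.FiniteIndex] {q : ℕ} (hq5 : 5 ≤ q) (hHq : H.normalCore.index < q)
    {f : H →* Equiv.Perm (Fin q)} (hf : Function.Surjective f) {N : Subgroup G} [N.Normal]
    (hN : q ∣ (f.ker.map H.subtype).normalCore.relIndex N) :
    12 ∣ (f.ker.map H.subtype).normalCore.relIndex N := by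
  set L := f.ker.map H.subtype
  have hLker : L.subgroupOf H = f.ker := Subgroup.comap_map_eq_self_of_injective
    H.subtype_injective _
  have hdvd : L.relIndex (N ⊓ H) ∣ L.normalCore.relIndex N := by
    have h1 : L.normalCore.relIndex (N ⊓ H) ∣ L.normalCore.relIndex N := by
      rw [← Subgroup.relIndex_subgroupOf (inf_le_left : N ⊓ H ≤ N)]
      exact Subgroup.relIndex_dvd_index_of_normal _ _
    exact (Subgroup.relIndex_dvd_of_le_left _ L.normalCore_le).trans h1
  have hcard : L.relIndex (N ⊓ H) = Nat.card ((N.subgroupOf H).map f) := by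
    rw [← Subgroup.relIndex_ker, ← hLker, ← Subgroup.inf_subgroupOf_right N H,
      Subgroup.relIndex_subgroupOf inf_le_right]
  rw [hcard] at hdvd
  have : ((N.subgroupOf H).map f).Normal := Subgroup.Normal.map inferInstance f hf
  refine (Equiv.Perm.twelve_dvd_card_of_normal hq5 fun hbot => ?_).trans hdvd
  -- With trivial image, `N ∩ H ≤ L`, so the normal subgroup `N ∩ H.normalCore` lies in the core of
  -- `L`, and `q` would divide `H.normalCore.index < q`.
  rw [hbot, Subgroup.card_bot, Subgroup.relIndex_eq_one] at hcard
  have hle : N ⊓ H.normalCore ≤ L.normalCore :=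
    Subgroup.normal_le_normalCore.2 ((inf_le_inf_left N H.normalCore_le).trans hcard)
  have hd : L.normalCore.relIndex N ∣ H.normalCore.index :=
    (Subgroup.relIndex_dvd_of_le_left N hle).trans
      (by rw [Subgroup.inf_relIndex_left]; exact Subgroup.relIndex_dvd_index_of_normal _ _)
  exact absurd (Nat.le_of_dvd (Nat.pos_of_ne_zero Subgroup.FiniteIndex.index_ne_zero)
    (hN.trans hd)) (not_le.2 hHq)

theorem mainTheorem5 {G : Type*} [Group G] (hG : IsLargeGroup G) (p : ℕ) (hp : p.Prime) :
    ∃ C : (pLocalCommensurabilityGraph p G).ConnectedComponent,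
      ∀ A ∈ C.supp, ¬ (A : Subgroup G).Normal := by
  obtain ⟨H, hH, ι, f, hcyc, hf⟩ := hG
  -- The summands ensure that `q` exceeds the core's index, that `q ≠ p`, and that `q ≥ 5`, so also
  -- `q ≠ 2, 3`.
  obtain ⟨q, hqle, hq⟩ := Nat.exists_infinite_primes (H.normalCore.index + p + 5)
  obtain ⟨g, hg⟩ := FreeGroup.exists_surjective_perm hcyc hq
  let φ : H →* Equiv.Perm (Fin q) := g.comp f
  have hφ : Function.Surjective φ := hg.comp hf
  let L : Subgroup G := φ.ker.map H.subtype
  have hLindex : L.index = Nat.factorial q * H.index := by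
    rw [Subgroup.index_map_subtype, Subgroup.index_ker, MonoidHom.range_eq_top.2 hφ,
      Subgroup.card_top, Nat.card_perm, Nat.card_fin]
  have : L.FiniteIndex :=
    ⟨by rw [hLindex]; exact mul_ne_zero (Nat.factorial_ne_zero q) hH.index_ne_zero⟩
  have hqM : q ∣ L.normalCore.index :=
    ((hq.dvd_factorial.2 le_rfl).trans (Dvd.intro _ hLindex.symm)).trans
      (Subgroup.index_dvd_of_le L.normalCore_le)
  obtain ⟨A, hA, hAq⟩ := L.normalCore.exists_relIndex_eq_prime hq hqM
  refine ⟨(pLocalCommensurabilityGraph p G).connectedComponentMk ⟨A, hA⟩, fun N hN hNn => ?_⟩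
  obtain ⟨a, b, hab⟩ := pLocalCommensurabilityGraph.pow_mul_relIndex_eq_of_reachable hp
    L.normalCore (SimpleGraph.ConnectedComponent.exact hN)
  rw [hAq] at hab
  have hqN : q ∣ L.normalCore.relIndex N.1 := by
    refine (hq.dvd_mul.1 (Dvd.intro_left _ hab.symm)).resolve_left fun h => ?_
    have := (Nat.prime_dvd_prime_iff_eq hq hp).1 (hq.dvd_of_dvd_pow h)
    omega
  have h12 : 12 ∣ L.normalCore.relIndex N.1 :=
    Subgroup.twelve_dvd_relIndex_normalCore (by omega) (by omega) hφ hqN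
  have key (r : ℕ) (hr : r.Prime) (hr5 : r < 5) (hr12 : r ∣ 12) : r = p := by
    have h : r ∣ p ^ b * q := hab ▸ (hr12.trans h12).mul_left _
    rcases hr.dvd_mul.1 h with h | h
    · exact (Nat.prime_dvd_prime_iff_eq hr hp).1 (hr.dvd_of_dvd_pow h)
    · have := (Nat.prime_dvd_prime_iff_eq hr hq).1 h
      omega
  have h2 := key 2 Nat.prime_two (by norm_num) (by norm_num)
  have h3 := key 3 Nat.prime_three (by norm_num) (by norm_num)
  omega
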